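/- Let $B$ be the $\mathbb Z$-infinite Pascal–Bratteli diagram. For $n\ge 1$ its level $V_n$ is the set of vectors $\bar s=(s_i)_{i\in\mathbb Z}$ of non-negative integers with $\sum_{i\in\mathbb Z}s_i=n$; there is exactly one edge from $\bar s\in V_n$ to $\bar t\in V_{n+1}$ if $\bar t=\bar s+\bar e^{(i)}$ for some $i\in\mathbb Z$ (where $\bar e^{(i)}$ is the $i$-th standard basis vector), and there is none otherwise. Let $X_B$ be the space of infinite paths starting in $V_1$, with the topology and the Borel $\sigma$-algebra generated by the cylinder sets $[\bar e]$ (the set of all infinite paths that begin with the finite path $\bar e$ starting in $V_1$). Two paths are tail equivalent if their edges coincide from some level on. A Borel probability measure $\mu$ on $X_B$ (atoms are allowed) is tail invariant if $\mu([\bar e])=\mu([\bar e'])$ whenever the finite paths $\bar e,\bar e'$ starting in $V_1$ end at the same vertex, and it is ergodic if every Borel set that is a union of tail equivalence classes has $\mu$-measure $0$ or $1$. For every probability vector $\bar d=(d_i)_{i\in\mathbb Z}$ (that is, $d_i\ge 0$ and $\sum_{i\in\mathbb Z} d_i=1$) there is exactly one tail invariant Borel probability measure $\mu_{\bar d}$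 on $X_B$ such that $$\mu_{\bar d}([\bar e_{\bar s}])=\prod_{i\in\mathbb Z}d_i^{\,s_i}\qquad (0^0=1)$$ for every $n\ge1$, every $\bar s\in V_n$ and every finite path $\bar e_{\bar s}$ from $V_1$ to $\bar s$. Moreover, the ergodic tail invariant Borel probability measures on $X_B$ are exactly the measures $\mu_{\bar d}$, where $\bar d$ runs over all probability vectors indexed by $\mathbb Z$. -/

import Mathlib

open MeasureTheory
open scoped NNReal ENNReal

/-- A generalized Bratteli diagram: a graded graph with countably infinite levels `V n`, countable
edge sets `E n` between `V n` and `V (n + 1)`, source and range maps that are onto the respective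
levels, and finitely many edges ending at each vertex outside the initial level. -/
structure GenBratteliDiagram where
  V : ℕ → Type
  E : ℕ → Type
  src : ∀ {n : ℕ}, E n → V n
  rng : ∀ {n : ℕ}, E n → V (n + 1)
  countable_V : ∀ n, Countable (V n)
  infinite_V : ∀ n, Infinite (V n)
  countable_E : ∀ n, Countable (E n)
  src_surjective : ∀ n, Function.Surjective (src : E n → V n)
  rng_surjective : ∀ n, Function.Surjective (rng : E n → V (n + 1))
  finite_rng_fiber : ∀ n (v : V (n + 1)), {e : E n | rng e = v}.Finite

namespace GenBratteliDiagram

/-- The path space: infinite paths that start at the initial level `V 0`. -/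
@[ext]
structure InfPath (B : GenBratteliDiagram) where
  edge : ∀ n : ℕ, B.E n
  chain : ∀ n : ℕ, B.rng (edge n) = B.src (edge (n + 1))

/-- Finite paths with `n` edges from the initial level `V 0` to the level `V n`, recorded with
the vertices that they visit (so that a path with no edges is a vertex of `V 0`). -/
structure FinPath (B : GenBratteliDiagram) (n : ℕ) where
  vert : ∀ i : Fin (n + 1), B.V i
  edge : ∀ i : Fin n, B.E i
  src_edge : ∀ i : Fin n, B.src (edge i) = vert i.castSucc
  rng_edge : ∀ i : Fin n, B.rng (edge i) = vert i.succ

/-- The range of a finite path: its last vertex. -/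
def FinPath.range {B : GenBratteliDiagram} {n : ℕ} (p : B.FinPath n) : B.V n :=
  p.vert (Fin.last n)

/-- The cylinder set of a finite path: all infinite paths that begin with it. -/
def cylinder {B : GenBratteliDiagram} {n : ℕ} (p : B.FinPath n) : Set B.InfPath :=
  {x | B.src (x.edge 0) = p.vert 0 ∧ ∀ i : Fin n, x.edge i = p.edge i}

/-- The topology on the path space is generated by the cylinder sets. -/
instance (B : GenBratteliDiagram) : TopologicalSpace B.InfPath :=
  TopologicalSpace.generateFrom {C | ∃ (n : ℕ) (p : B.FinPath n), C = cylinder p}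

/-- The path space carries its Borel sigma-algebra. -/
instance (B : GenBratteliDiagram) : MeasurableSpace B.InfPath := borel B.InfPath

instance (B : GenBratteliDiagram) : BorelSpace B.InfPath := ⟨rfl⟩

/-- Tail equivalence: the two paths have the same edges from some level on. -/
def TailEquiv {B : GenBratteliDiagram} (x y : B.InfPath) : Prop :=
  ∃ n : ℕ, ∀ i : ℕ, n ≤ i → x.edge i = y.edge i

/-- A measure is tail invariant if the cylinder sets of any two finite paths
with the same range have the same measure. -/
def TailInvariant {B : GenBratteliDiagram} (μ : Measure B.InfPath) : Prop :=
  ∀ (n : ℕ) (p q : B.FinPath n), p.range = q.range → μ (cylinder p) = μ (cylinder q)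

/-- Ergodicity for the tail equivalence relation: every Borel set that is a union of tail
equivalence classes is null or conull. -/
def TailErgodic {B : GenBratteliDiagram} (μ : Measure B.InfPath) : Prop :=
  ∀ A : Set B.InfPath, MeasurableSet A → (∀ x y, TailEquiv x y → (x ∈ A ↔ y ∈ A)) →
    μ A = 0 ∨ μ Aᶜ = 0

end GenBratteliDiagram

/-- Vertices of the `ℤ`-infinite Pascal-Bratteli diagram: finitely supported vectors
of non-negative integers, indexed by `ℤ`, with entries summing to `m`. -/
def ZPascalVertex (m : ℕ) : Type := {s : ℤ →₀ ℕ // (s.sum fun _ k => k) = m}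

/-- There is exactly one edge from `s` to `t` if `t = s + e⁽ⁱ⁾` for some `i`, and none otherwise. -/
def ZPascalEdge (m : ℕ) : Type :=
  {p : ZPascalVertex m × ZPascalVertex (m + 1) // ∃ i : ℤ, p.2.1 = p.1.1 + Finsupp.single i 1}

/-- The `ℤ`-infinite Pascal-Bratteli diagram. Its initial level consists of the vectors with sum 1,
that is, of the standard basis vectors; so the `n`-th level (counted from `0`)
consists of the vectors with sum `n + 1`. -/
def zPascal : GenBratteliDiagram where
  V n := ZPascalVertex (n + 1)
  E n := ZPascalEdge (n + 1)
  src e := e.1.1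
  rng e := e.1.2
  countable_V n := by unfold ZPascalVertex; infer_instance
  infinite_V n := by
    refine Infinite.of_injective
      (fun i : ℤ => (⟨Finsupp.single i (n + 1), Finsupp.sum_single_index rfl⟩ : ZPascalVertex (n + 1))) ?_
    intro i j h
    have h' := congrArg Subtype.val h
    exact Finsupp.single_left_injective (Nat.succ_ne_zero n) h'
  countable_E n := by unfold ZPascalEdge ZPascalVertex; infer_instance
  src_surjective n s := by
    refine ⟨⟨(s, ⟨s.1 + Finsupp.single 0 1, ?_⟩), 0, rfl⟩, rfl⟩
    rw [Finsupp.sum_add_index' (by simp) (by simp), s.2]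
    simp
  rng_surjective n t := by
    obtain ⟨i, hi⟩ : ∃ i, t.1 i ≠ 0 := by
      by_contra! h
      have h0 : t.1 = 0 := Finsupp.ext h
      have := t.2
      rw [h0] at this
      simp at this
    have hle : Finsupp.single i 1 ≤ t.1 := by
      rw [Finsupp.single_le_iff]; omega
    have hadd : t.1 = (t.1 - Finsupp.single i 1) + Finsupp.single i 1 :=
      (tsub_add_cancel_of_le hle).symm
    refine ⟨⟨(⟨t.1 - Finsupp.single i 1, ?_⟩, t), i, hadd⟩, rfl⟩
    have h2 := t.2
    rw [hadd, Finsupp.sum_add_index' (by simp) (by simp)] at h2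
    simpa using h2
  finite_rng_fiber n t := by
    refine Set.Finite.of_finite_image (f := fun e : ZPascalEdge (n + 1) => e.1.1.1) ?_ ?_
    · refine (Set.finite_Iic t.1).subset ?_
      rintro _ ⟨e, he, rfl⟩
      obtain ⟨i, hi⟩ := e.2
      have he' : e.1.2 = t := he
      rw [he'] at hi
      rw [Set.mem_Iic, hi]
      exact le_self_add
    · intro e he f hf h
      have he' : e.1.2 = t := he
      have hf' : f.1.2 = t := hf
      exact Subtype.ext (Prod.ext (Subtype.ext h) (he'.trans hf'.symm))

/-- `μ` is the measure `μ_d`: a tail invariant Borel probability measure on the path space of the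
`ℤ`-infinite Pascal-Bratteli diagram for which the cylinder set of every finite path with range
`s = (s_i)` has measure `∏ d_i ^ s_i`. -/
structure IsZPascalMeasure (d : ℤ → ℝ≥0) (μ : Measure zPascal.InfPath) : Prop where
  prob : IsProbabilityMeasure μ
  tailInvariant : GenBratteliDiagram.TailInvariant μ
  cylinder_eq : ∀ (n : ℕ) (p : zPascal.FinPath n),
    μ (GenBratteliDiagram.cylinder p) = ((p.range.1.prod fun i k => d i ^ k : ℝ≥0) : ℝ≥0∞)

/-! An infinite path is the same as the integer sequence of its steps: the initial vertex is the
first step, and each edge adds one more basis vector. Under this bijection (`pathEquiv`) a vertex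
records how often each integer has occurred, so tail invariance becomes exchangeability, tail
equivalence becomes equality up to a permutation of finitely many places, and `μ_d` becomes the law
of an i.i.d. sequence with point masses `d`.

The theorem is then the ergodic form of de Finetti's theorem together with the Hewitt–Savage
zero-one law. An exchangeable tail ergodic law is ergodic for the shift; the mean ergodic theorem
and exchangeability make its cylinder measures products (`Exchangeable.measure_cyl_of_tailErgodic`).
Conversely, an event invariant under finite permutations is independent of itself under an i.i.d.
law (`tailErgodic_iidMeasure`). -/

open Filter Topology

/-! ### Cylinders and exchangeable laws on integer sequences. -/

namespace IntSeq

/-- The set of integer sequences that agree with `w` in the first `n` places. -/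
def cyl (w : ℕ → ℤ) (n : ℕ) : Set (ℕ → ℤ) := {v | ∀ k < n, v k = w k}

/-- How often each integer occurs among the first `n` terms of `w`. -/
noncomputable def counts (w : ℕ → ℤ) (n : ℕ) : ℤ →₀ ℕ :=
  ∑ k ∈ Finset.range n, Finsupp.single (w k) 1

lemma counts_succ (w : ℕ → ℤ) (n : ℕ) :
    counts w (n + 1) = counts w n + Finsupp.single (w n) 1 :=
  Finset.sum_range_succ _ _

lemma counts_congr {v w : ℕ → ℤ} {n : ℕ} (h : ∀ k < n, v k = w k) : counts v n = counts w n :=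
  Finset.sum_congr rfl fun k hk => by rw [h k (Finset.mem_range.1 hk)]

lemma mem_range_iff_of_fix {σ : Equiv.Perm ℕ} {N n : ℕ} (hσ : ∀ k, N ≤ k → σ k = k)
    (hn : N ≤ n) (k : ℕ) : σ k < n ↔ k < n := by
  constructor
  · intro h
    by_contra! hk
    rw [hσ k (hn.trans hk)] at h
    omega
  · intro h
    by_contra! hk
    have := σ.injective (hσ (σ k) (hn.trans hk))
    omega

lemma counts_comp_perm (w : ℕ → ℤ) {σ : Equiv.Perm ℕ} {N n : ℕ} (hσ : ∀ k, N ≤ k → σ k = k)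
    (hn : N ≤ n) : counts (w ∘ σ) n = counts w n :=
  Finset.sum_equiv σ (by simp [mem_range_iff_of_fix hσ hn]) (by simp)

lemma counts_prod {M : Type*} [CommMonoid M] (p : ℤ → M) (w : ℕ → ℤ) (n : ℕ) :
    ((counts w n).prod fun i k => p i ^ k) = ∏ k ∈ Finset.range n, p (w k) := by
  induction n with
  | zero => simp [counts]
  | succ n ih =>
    rw [counts_succ, Finset.prod_range_succ, ← ih,
      Finsupp.prod_add_index' (by simp) (by simp [pow_add]), Finsupp.prod_single_index (by simp),
      pow_one]

lemma counts_sum (w : ℕ → ℤ) (n : ℕ) : ((counts w n).sum fun _ k => k) = n := by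
  induction n with
  | zero => simp [counts]
  | succ n ih =>
    rw [counts_succ, Finsupp.sum_add_index' (by simp) (by simp), ih]
    simp

lemma measurable_comp_perm (σ : Equiv.Perm ℕ) : Measurable fun x : ℕ → ℤ => x ∘ σ :=
  measurable_pi_lambda _ fun k => measurable_pi_apply (σ k)

lemma measurableSet_cyl (w : ℕ → ℤ) (n : ℕ) : MeasurableSet (cyl w n) := by
  have : cyl w n = ⋂ k ∈ Set.Iio n, (fun x : ℕ → ℤ => x k) ⁻¹' {w k} := by
    ext; simp [cyl]
  rw [this]
  exact MeasurableSet.biInter (Set.to_countable _) fun k _ =>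
    measurable_pi_apply k (MeasurableSet.singleton _)

/-- The cylinders that fix at least the first `N` places. -/
def cyls (N : ℕ) : Set (Set (ℕ → ℤ)) := {C | ∃ w n, N ≤ n ∧ C = cyl w n}

lemma countable_cyls (N : ℕ) : (cyls N).Countable := by
  refine (Set.countable_range
    (fun a : Σ n, Fin n → ℤ => {x : ℕ → ℤ | ∀ k : Fin a.1, x k = a.2 k})).mono ?_
  rintro _ ⟨w, n, -, rfl⟩
  refine ⟨⟨n, fun k => w k⟩, ?_⟩
  ext x
  exact Fin.forall_iff

lemma isPiSystem_cyls (N : ℕ) : IsPiSystem (cyls N) := by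
  rintro _ ⟨w, n, hn, rfl⟩ _ ⟨v, m, hm, rfl⟩ ⟨u, hu, hu'⟩
  refine ⟨u, max n m, by omega, ?_⟩
  ext x
  simp only [cyl, Set.mem_inter_iff, Set.mem_ofPred_eq] at *
  constructor
  · rintro ⟨h, h'⟩ k hk
    rcases lt_max_iff.1 hk with hk | hk
    · rw [h k hk, hu k hk]
    · rw [h' k hk, hu' k hk]
  · intro h
    exact ⟨fun k hk => by rw [h k (by omega), hu k hk], fun k hk => by rw [h k (by omega), hu' k hk]⟩

lemma generateFrom_cyls (N : ℕ) :
    (MeasurableSpace.pi : MeasurableSpace (ℕ → ℤ)) = MeasurableSpace.generateFrom (cyls N) := by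
  apply le_antisymm
  · refine iSup_le fun k => ?_
    rw [← measurable_iff_comap_le]
    refine @measurable_to_countable' _ _ _ _ (MeasurableSpace.generateFrom (cyls N)) _ fun i => ?_
    have : (fun x : ℕ → ℤ => x k) ⁻¹' {i} =
        ⋃₀ {C ∈ cyls N | C ⊆ (fun x : ℕ → ℤ => x k) ⁻¹' {i}} := by
      apply subset_antisymm
      · intro x hx
        refine ⟨cyl x (max N (k + 1)), ⟨⟨x, _, le_max_left _ _, rfl⟩, fun y hy => ?_⟩,
          fun _ _ => rfl⟩
        exact (hy k (by omega)).trans hx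
      · exact Set.sUnion_subset fun C hC => hC.2
    rw [this]
    exact MeasurableSet.sUnion ((countable_cyls N).mono (Set.sep_subset _ _))
      fun C hC => MeasurableSpace.measurableSet_generateFrom hC.1
  · refine MeasurableSpace.generateFrom_le ?_
    rintro _ ⟨w, n, -, rfl⟩
    exact measurableSet_cyl w n

/-- Short cylinders may be ignored: a permutation moving places below `N` respects only cylinders of
length at least `N`, and finite paths give only cylinders of length at least `1`. -/
lemma ext_of_cyl {μ ν : Measure (ℕ → ℤ)} [IsProbabilityMeasure μ] [IsProbabilityMeasure ν] (N : ℕ)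
    (h : ∀ w n, N ≤ n → μ (cyl w n) = ν (cyl w n)) : μ = ν := by
  refine ext_of_generate_finite (cyls N) (generateFrom_cyls N) (isPiSystem_cyls N) ?_ (by simp)
  rintro _ ⟨w, n, hn, rfl⟩
  exact h w n hn

/-- The measure of a cylinder depends only on the numbers of occurrences of the integers. -/
def Exchangeable (ν : Measure (ℕ → ℤ)) : Prop :=
  ∀ n v w, counts v n = counts w n → ν (cyl v n) = ν (cyl w n)

lemma preimage_comp_perm_cyl {σ : Equiv.Perm ℕ} {N n : ℕ} (hσ : ∀ k, N ≤ k → σ k = k)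
    (hn : N ≤ n) (w : ℕ → ℤ) :
    (fun x : ℕ → ℤ => x ∘ σ) ⁻¹' cyl w n = cyl (w ∘ σ.symm) n := by
  ext x
  simp only [cyl, Set.mem_preimage, Set.mem_ofPred_eq, Function.comp_apply]
  constructor
  · intro h k hk
    have := h (σ.symm k) ((mem_range_iff_of_fix hσ hn _).1 (by simpa))
    simpa using this
  · intro h k hk
    simpa using h (σ k) ((mem_range_iff_of_fix hσ hn _).2 hk)

lemma symm_fix {σ : Equiv.Perm ℕ} {N : ℕ} (hσ : ∀ k, N ≤ k → σ k = k) (k : ℕ) (hk : N ≤ k) :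
    σ.symm k = k := by
  rw [Equiv.symm_apply_eq, hσ k hk]

lemma Exchangeable.measurePreserving_comp_perm {ν : Measure (ℕ → ℤ)} [IsProbabilityMeasure ν]
    (h : Exchangeable ν) {σ : Equiv.Perm ℕ} {N : ℕ} (hσ : ∀ k, N ≤ k → σ k = k) :
    MeasurePreserving (fun x : ℕ → ℤ => x ∘ σ) ν ν := by
  refine ⟨measurable_comp_perm σ, ?_⟩
  have := Measure.isProbabilityMeasure_map (μ := ν) (measurable_comp_perm σ).aemeasurable
  refine ext_of_cyl N fun w n hn => ?_
  rw [Measure.map_apply (measurable_comp_perm σ) (measurableSet_cyl w n),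
    preimage_comp_perm_cyl hσ hn]
  exact h n _ _ (counts_comp_perm w (symm_fix hσ) hn)

/-! ### Special permutations, the shift and its ergodicity. -/

/-- The permutation that rotates `0, …, n` and fixes all larger numbers. -/
def rotate (n : ℕ) : Equiv.Perm ℕ where
  toFun k := if k < n then k + 1 else if k = n then 0 else k
  invFun k := if k = 0 then n else if k ≤ n then k - 1 else k
  left_inv k := by grind
  right_inv k := by grind

/-- The permutation that swaps the blocks `0, …, n - 1` and `n, …, 2 * n - 1`. -/
def blockSwap (n : ℕ) : Equiv.Perm ℕ where
  toFun k := if k < n then k + n else if k < 2 * n then k - n else k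
  invFun k := if k < n then k + n else if k < 2 * n then k - n else k
  left_inv k := by grind
  right_inv k := by grind

lemma blockSwap_fix (n k : ℕ) (hk : 2 * n ≤ k) : blockSwap n k = k := by
  simp only [blockSwap, Equiv.coe_fn_mk]
  grind

/-- The left shift of sequences. -/
def shift (x : ℕ → ℤ) : ℕ → ℤ := fun k => x (k + 1)

lemma shift_iterate (n : ℕ) (x : ℕ → ℤ) (k : ℕ) : shift^[n] x k = x (k + n) := by
  induction n generalizing x with
  | zero => rfl
  | succ n ih => rw [Function.iterate_succ_apply, ih]; simp [shift, add_assoc]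

lemma measurable_shift : Measurable shift :=
  measurable_pi_lambda _ fun k => measurable_pi_apply (k + 1)

/-- The shift permutes infinitely many places, but on the first `n` places it agrees with `rotate
n`, a finite permutation. -/
lemma Exchangeable.measurePreserving_shift {ν : Measure (ℕ → ℤ)} [IsProbabilityMeasure ν]
    (h : Exchangeable ν) : MeasurePreserving shift ν ν := by
  refine ⟨measurable_shift, ?_⟩
  have := Measure.isProbabilityMeasure_map (μ := ν) measurable_shift.aemeasurable
  refine ext_of_cyl 0 fun w n _ => ?_
  rw [Measure.map_apply measurable_shift (measurableSet_cyl w n)]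
  have hfix : ∀ k, n + 1 ≤ k → rotate n k = k := by
    intro k hk
    simp only [rotate, Equiv.coe_fn_mk]
    grind
  have : shift ⁻¹' cyl w n = (fun x : ℕ → ℤ => x ∘ rotate n) ⁻¹' cyl w n := by
    ext x
    refine forall₂_congr fun k hk => ?_
    simp [shift, rotate, hk]
  rw [this, (h.measurePreserving_comp_perm hfix).measure_preimage
    (measurableSet_cyl w n).nullMeasurableSet]

/-- Two sequences agree from some place on, and before it they have the same terms up to order. -/
def TailEquiv (v w : ℕ → ℤ) : Prop :=
  ∃ n, counts v n = counts w n ∧ ∀ k, n ≤ k → v k = w k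

/-- Every measurable set that is invariant under `IntSeq.TailEquiv` is null or conull. -/
def TailErgodic (ν : Measure (ℕ → ℤ)) : Prop :=
  ∀ A : Set (ℕ → ℤ), MeasurableSet A → (∀ v w, TailEquiv v w → (v ∈ A ↔ w ∈ A)) →
    ν A = 0 ∨ ν Aᶜ = 0

/-- Tail equivalent sequences coincide after enough shifts, so a shift-invariant set is a union of
tail classes. -/
lemma TailErgodic.ergodic_shift {ν : Measure (ℕ → ℤ)} [IsProbabilityMeasure ν]
    (h : Exchangeable ν) (he : TailErgodic ν) : Ergodic shift ν := by
  refine { h.measurePreserving_shift with aeconst_set := fun A hA hinv => ?_ }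
  have hit : ∀ n x, x ∈ A ↔ shift^[n] x ∈ A := by
    intro n x
    rw [← Set.mem_preimage, Set.preimage_iterate_eq, Function.iterate_fixed hinv]
  rw [eventuallyConst_set', ae_eq_empty, ae_eq_univ]
  exact he A hA fun v w ⟨n, _, hn⟩ => by
    rw [hit n v, hit n w]
    have : shift^[n] v = shift^[n] w := by
      ext k
      rw [shift_iterate, shift_iterate, hn _ (by omega)]
    rw [this]

end IntSeq

/-! ### Mixing in Cesàro mean. -/

/-- A consequence of the mean ergodic theorem: the mixing property in Cesàro mean. -/
lemma Ergodic.tendsto_cesaro_measureReal_inter {α : Type*} [MeasurableSpace α] {μ : Measure α}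
    [IsProbabilityMeasure μ] {T : α → α} (hT : Ergodic T μ) {A B : Set α}
    (hA : MeasurableSet A) (hB : MeasurableSet B) :
    Tendsto (fun N : ℕ => (N : ℝ)⁻¹ * ∑ k ∈ Finset.range N, μ.real (B ∩ T^[k] ⁻¹' A)) atTop
      (𝓝 (μ.real B * μ.real A)) := by
  have hmp := hT.toMeasurePreserving
  let U : Lp ℝ 2 μ →L[ℝ] Lp ℝ 2 μ :=
    (Lp.compMeasurePreservingₗᵢ ℝ T hmp).toContinuousLinearMap
  let f : Lp ℝ 2 μ := indicatorConstLp 2 hA (measure_ne_top μ A) (1 : ℝ)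
  have hU : ‖U‖ ≤ 1 := LinearIsometry.norm_toContinuousLinearMap_le _
  -- The averages of the indicator of `A` converge in L² to its projection onto the fixed vectors of
  -- `U`; by ergodicity this limit is a constant `c`.
  obtain ⟨g, hg, hlim⟩ : ∃ g : Lp ℝ 2 μ, U g = g ∧
      Tendsto (birkhoffAverage ℝ U _root_.id · f) atTop (𝓝 g) :=
    ⟨_, ((U.eqLocus (1 : Lp ℝ 2 μ →L[ℝ] Lp ℝ 2 μ)).orthogonalProjectionOnto f).2,
      U.tendsto_birkhoffAverage_orthogonalProjection hU f⟩
  obtain ⟨c, hc⟩ : ∃ c : ℝ, g.1 = AEEqFun.const α c :=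
    hT.eq_const_of_compMeasurePreserving_eq (congrArg Subtype.val hg)
  have hgc : ∀ᵐ x ∂μ, g x = c := by
    have := AEEqFun.coeFn_const (μ := μ) α c
    rw [← hc] at this
    exact this
  have hiter : ∀ k, U^[k] f = indicatorConstLp 2 ((hmp.iterate k).measurable hA)
      (measure_ne_top μ _) (1 : ℝ) := by
    intro k
    change (Lp.compMeasurePreserving T hmp)^[k] f = _
    rw [Lp.compMeasurePreserving_iterate]
    exact Lp.indicatorConstLp_compMeasurePreserving hA _ _ (hmp.iterate k)
  have key : ∀ C : Set α, MeasurableSet C →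
      Tendsto (fun N : ℕ => (N : ℝ)⁻¹ * ∑ k ∈ Finset.range N, μ.real (C ∩ T^[k] ⁻¹' A)) atTop
        (𝓝 (μ.real C * c)) := by
    intro C hC
    let i : Lp ℝ 2 μ := indicatorConstLp 2 hC (measure_ne_top μ C) (1 : ℝ)
    have h1 : Tendsto (fun N => inner ℝ i (birkhoffAverage ℝ U _root_.id N f)) atTop
        (𝓝 (inner ℝ i g)) := tendsto_const_nhds.inner hlim
    have h2 : inner ℝ i g = μ.real C * c := by
      rw [L2.inner_indicatorConstLp_one,
        setIntegral_congr_ae hC (hgc.mono fun x hx _ => hx)]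
      simp
    rw [h2] at h1
    refine h1.congr fun N => ?_
    rw [birkhoffAverage, birkhoffSum, inner_smul_right, inner_sum]
    congr 1
    refine Finset.sum_congr rfl fun k _ => ?_
    rw [id, hiter, L2.inner_indicatorConstLp_indicatorConstLp]
    simp
  -- Pairing with the whole space identifies the constant.
  have hcA : μ.real A = c := by
    have h1 := key Set.univ MeasurableSet.univ
    have h2 : ∀ k, μ.real (T^[k] ⁻¹' A) = μ.real A := fun k =>
      (hmp.iterate k).measureReal_preimage hA.nullMeasurableSet
    simp only [Set.univ_inter, h2, probReal_univ, one_mul] at h1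
    exact tendsto_nhds_unique (tendsto_const_nhds.cesaro) h1
  rw [hcA]
  exact key B hB

/-! ### De Finetti's theorem. -/

namespace IntSeq

lemma cyl_succ (w : ℕ → ℤ) (n : ℕ) :
    cyl w (n + 1) = cyl w n ∩ (fun x : ℕ → ℤ => x n) ⁻¹' {w n} := by
  ext x
  exact Nat.forall_lt_succ_right

/-- The distribution of the first term. -/
noncomputable def firstProb (ν : Measure (ℕ → ℤ)) (i : ℤ) : ℝ≥0 :=
  (ν ((fun x : ℕ → ℤ => x 0) ⁻¹' {i})).toNNReal

lemma hasSum_firstProb (ν : Measure (ℕ → ℤ)) [IsProbabilityMeasure ν] :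
    HasSum (firstProb ν) 1 := by
  rw [← ENNReal.hasSum_coe]
  have h0 : Measurable fun x : ℕ → ℤ => x 0 := measurable_pi_apply 0
  have h : ∑' i, (firstProb ν i : ℝ≥0∞) = 1 := by
    simp only [firstProb, ENNReal.coe_toNNReal (measure_ne_top ν _)]
    rw [← measure_iUnion (fun i j hij => Disjoint.preimage _ (by simpa using hij))
      (fun i => h0 (MeasurableSet.singleton i)), ← Set.preimage_iUnion,
      Set.iUnion_of_singleton, Set.preimage_univ, measure_univ]
  rw [ENNReal.coe_one, ← h]
  exact ENNReal.summable.hasSum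

/-- **De Finetti's theorem**, ergodic case. -/
theorem Exchangeable.measure_cyl_of_tailErgodic {ν : Measure (ℕ → ℤ)} [IsProbabilityMeasure ν]
    (h : Exchangeable ν) (he : TailErgodic ν) (w : ℕ → ℤ) (n : ℕ) :
    ν (cyl w n) = ((∏ k ∈ Finset.range n, firstProb ν (w k) : ℝ≥0) : ℝ≥0∞) := by
  induction n with
  | zero => simp [cyl]
  | succ n ih =>
    have hT := TailErgodic.ergodic_shift h he
    set A : Set (ℕ → ℤ) := (fun x : ℕ → ℤ => x 0) ⁻¹' {w n} with hA_def
    have hA : MeasurableSet A := measurable_pi_apply 0 (MeasurableSet.singleton _)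
    -- Swapping the places `n` and `k` leaves the first `n` places alone, so by exchangeability the
    -- averaged sequence is eventually constant, and its Cesàro limit is that constant.
    have hconst : ∀ k, n ≤ k → ν.real (cyl w n ∩ shift^[k] ⁻¹' A) = ν.real (cyl w (n + 1)) := by
      intro k hk
      have hfix : ∀ j, k + 1 ≤ j → Equiv.swap n k j = j := fun j hj =>
        Equiv.swap_apply_of_ne_of_ne (by omega) (by omega)
      rw [← (h.measurePreserving_comp_perm hfix).measureReal_preimage
        (measurableSet_cyl w (n + 1)).nullMeasurableSet, cyl_succ]
      congr 1
      ext x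
      refine and_congr (forall₂_congr fun j hj => ?_) ?_
      · simp only [Function.comp_apply]
        rw [Equiv.swap_apply_of_ne_of_ne (by omega) (by omega)]
      · simp [hA_def, shift_iterate]
    have hlim : Tendsto (fun k => ν.real (cyl w n ∩ shift^[k] ⁻¹' A)) atTop
        (𝓝 (ν.real (cyl w (n + 1)))) :=
      tendsto_const_nhds.congr' ((eventually_ge_atTop n).mono fun k hk => (hconst k hk).symm)
    have := tendsto_nhds_unique hlim.cesaro
      (hT.tendsto_cesaro_measureReal_inter hA (measurableSet_cyl w n))
    rw [← ENNReal.toReal_eq_toReal_iff' (measure_ne_top _ _) ENNReal.coe_ne_top,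
      Finset.prod_range_succ, ENNReal.coe_mul, ENNReal.toReal_mul, ← ih]
    exact this

lemma exchangeable_of_measure_cyl {ν : Measure (ℕ → ℤ)} {d : ℤ → ℝ≥0}
    (h : ∀ w n, ν (cyl w n) = ((∏ k ∈ Finset.range n, d (w k) : ℝ≥0) : ℝ≥0∞)) :
    Exchangeable ν := by
  intro n v w hvw
  rw [h, h, ← counts_prod, ← counts_prod, hvw]

/-! ### I.i.d. laws and the Hewitt–Savage law. -/

/-- The probability measure on `ℤ` with the given point masses. -/
noncomputable def pointMass (d : ℤ → ℝ≥0) (hd : HasSum d 1) : PMF ℤ :=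
  ⟨fun i => d i, ENNReal.hasSum_coe.2 hd⟩

/-- The distribution of a sequence of independent integers with point masses `d`. -/
noncomputable def iidMeasure (d : ℤ → ℝ≥0) (hd : HasSum d 1) : Measure (ℕ → ℤ) :=
  Measure.infinitePi fun _ => (pointMass d hd).toMeasure

instance (d : ℤ → ℝ≥0) (hd : HasSum d 1) : IsProbabilityMeasure (iidMeasure d hd) := by
  unfold iidMeasure
  infer_instance

lemma iidMeasure_pi (d : ℤ → ℝ≥0) (hd : HasSum d 1) (s : Finset ℕ) (w : ℕ → ℤ) :
    iidMeasure d hd {x | ∀ k ∈ s, x k = w k} = ((∏ k ∈ s, d (w k) : ℝ≥0) : ℝ≥0∞) := by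
  have : {x : ℕ → ℤ | ∀ k ∈ s, x k = w k} = Set.pi s fun k => {w k} := by
    ext
    simp [Set.mem_pi]
  rw [this, iidMeasure, Measure.infinitePi_pi _ fun k _ => MeasurableSet.singleton _,
    ENNReal.ofNNReal_finsetProd]
  refine Finset.prod_congr rfl fun k _ => ?_
  rw [PMF.toMeasure_apply_singleton _ _ (MeasurableSet.singleton _)]
  rfl

lemma iidMeasure_cyl (d : ℤ → ℝ≥0) (hd : HasSum d 1) (w : ℕ → ℤ) (n : ℕ) :
    iidMeasure d hd (cyl w n) = ((∏ k ∈ Finset.range n, d (w k) : ℝ≥0) : ℝ≥0∞) := by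
  rw [← iidMeasure_pi d hd]
  simp [cyl]

/-- The swap moves the conditions imposed by `w` to places from `n` on, disjoint from those of `v`;
the word `u` glues both sets of conditions together. -/
lemma iidMeasure_blockSwap_inter (d : ℤ → ℝ≥0) (hd : HasSum d 1) (w v : ℕ → ℤ) {m l n : ℕ}
    (hm : m ≤ n) (hl : l ≤ n) :
    iidMeasure d hd ((fun x : ℕ → ℤ => x ∘ blockSwap n) ⁻¹' cyl w m ∩ cyl v l) =
      iidMeasure d hd (cyl w m) * iidMeasure d hd (cyl v l) := by
  let s := (Finset.range m).map (addRightEmbedding n)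
  let u : ℕ → ℤ := fun k => if k < n then v k else w (k - n)
  have hdisj : Disjoint s (Finset.range l) := by
    rw [Finset.disjoint_left]
    intro k hk hk'
    simp only [s, Finset.mem_map, Finset.mem_range, addRightEmbedding_apply] at hk hk'
    omega
  have hset : (fun x : ℕ → ℤ => x ∘ blockSwap n) ⁻¹' cyl w m ∩ cyl v l =
      {x | ∀ k ∈ s ∪ Finset.range l, x k = u k} := by
    ext x
    simp only [Finset.forall_mem_union, s, Finset.forall_mem_map, Finset.mem_range,
      addRightEmbedding_apply]
    refine and_congr (forall₂_congr fun k hk => ?_) (forall₂_congr fun k hk => ?_)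
    · have : k < n := by omega
      simp [blockSwap, u, this]
    · have : k < n := by omega
      simp [u, this]
  rw [hset, iidMeasure_pi, Finset.prod_union hdisj, iidMeasure_cyl, iidMeasure_cyl,
    ENNReal.coe_mul, Finset.prod_map]
  congr 2
  · simp [u]
  · refine Finset.prod_congr rfl fun k hk => ?_
    have : k < n := by have := Finset.mem_range.1 hk; omega
    simp [u, this]

/-- The **Hewitt–Savage zero-one law**. -/
theorem tailErgodic_iidMeasure (d : ℤ → ℝ≥0) (hd : HasSum d 1) :
    TailErgodic (iidMeasure d hd) := by
  intro A hA hinv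
  set ν := iidMeasure d hd
  have hmp : ∀ n, MeasurePreserving (fun x : ℕ → ℤ => x ∘ blockSwap n) ν ν := fun n =>
    (exchangeable_of_measure_cyl (iidMeasure_cyl d hd)).measurePreserving_comp_perm (blockSwap_fix n)
  have hAinv : ∀ n, (fun x : ℕ → ℤ => x ∘ blockSwap n) ⁻¹' A = A := by
    intro n
    ext x
    exact hinv _ _ ⟨2 * n, counts_comp_perm x (blockSwap_fix n) le_rfl,
      fun k hk => congrArg x (blockSwap_fix n k hk)⟩
  -- Swapped cylinders become asymptotically independent of every `D`. For a cylinder `D` equality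
  -- holds once `n` is large; a Dynkin class argument, with dominated convergence for disjoint
  -- unions, gives the rest.
  have hmix : ∀ w m (D : Set (ℕ → ℤ)), MeasurableSet D →
      Tendsto (fun n => ν.real ((fun x : ℕ → ℤ => x ∘ blockSwap n) ⁻¹' cyl w m ∩ D)) atTop
        (𝓝 (ν.real (cyl w m) * ν.real D)) := by
    intro w m
    have hS : ∀ n, MeasurableSet ((fun x : ℕ → ℤ => x ∘ blockSwap n) ⁻¹' cyl w m) := fun n =>
      (hmp n).measurable (measurableSet_cyl w m)
    refine MeasurableSpace.induction_on_inter (generateFrom_cyls 0) (isPiSystem_cyls 0)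
      (by simp) ?_ ?_ ?_
    · rintro _ ⟨v, l, -, rfl⟩
      refine tendsto_const_nhds.congr' ((eventually_ge_atTop (max m l)).mono fun n hn => ?_)
      simp only [measureReal_def]
      rw [ ← ENNReal.toReal_mul, ← iidMeasure_blockSwap_inter d hd w v (le_of_max_le_left hn) (le_of_max_le_right hn)]
    · intro D hD ih
      have h1 : ∀ n, ν.real ((fun x : ℕ → ℤ => x ∘ blockSwap n) ⁻¹' cyl w m ∩ Dᶜ) =
          ν.real (cyl w m) -
            ν.real ((fun x : ℕ → ℤ => x ∘ blockSwap n) ⁻¹' cyl w m ∩ D) := by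
        intro n
        rw [← (hmp n).measureReal_preimage (measurableSet_cyl w m).nullMeasurableSet,
          ← measureReal_inter_add_sdiff (s := _ ⁻¹' cyl w m) hD, Set.sdiff_eq]
        ring
      simp only [h1, probReal_compl_eq_one_sub hD, mul_sub, mul_one]
      exact tendsto_const_nhds.sub ih
    · intro f hdisj hf ih
      have h1 : ∀ C : Set (ℕ → ℤ), MeasurableSet C →
          HasSum (fun i => ν.real (C ∩ f i)) (ν.real (C ∩ ⋃ i, f i)) := by
        intro C hC
        rw [Set.inter_iUnion]
        have hp : Pairwise (Function.onFun Disjoint fun i => C ∩ f i) := fun i j hij =>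
          (hdisj hij).mono Set.inter_subset_right Set.inter_subset_right
        rw [measureReal_def, measure_iUnion hp fun i => hC.inter (hf i)]
        have hne : ∑' i, ν (C ∩ f i) ≠ ∞ := by
          rw [← measure_iUnion hp fun i => hC.inter (hf i)]
          exact measure_ne_top _ _
        rw [ENNReal.tsum_toReal_eq fun i => measure_ne_top _ _]
        exact ENNReal.hasSum_toReal hne
      have h2 := h1 Set.univ MeasurableSet.univ
      simp only [Set.univ_inter] at h2
      rw [← (h2.mul_left _).tsum_eq]
      simp only [← fun n => (h1 _ (hS n)).tsum_eq]
      exact tendsto_tsum_of_dominated_convergence h2.summable ih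
        (Eventually.of_forall fun n i => by
          rw [Real.norm_of_nonneg measureReal_nonneg]
          exact measureReal_mono Set.inter_subset_right)
  -- For `D = A`, invariance of `A` under the swaps makes the sequence in `hmix` constant.
  have hind : ∀ w m, ν.real (cyl w m ∩ A) = ν.real (cyl w m) * ν.real A := by
    intro w m
    refine tendsto_nhds_unique (tendsto_const_nhds.congr fun n => ?_) (hmix w m A hA)
    nth_rw 2 [← hAinv n]
    rw [← Set.preimage_inter, (hmp n).measureReal_preimage
      ((measurableSet_cyl w m).inter hA).nullMeasurableSet]
  have hAA : ∀ D : Set (ℕ → ℤ), MeasurableSet D → ν (D ∩ A) = ν A * ν D := by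
    have : ν.restrict A = ν A • ν := by
      refine ext_of_generate_finite (cyls 0) (generateFrom_cyls 0) (isPiSystem_cyls 0) ?_ (by simp)
      rintro _ ⟨w, m, -, rfl⟩
      rw [Measure.restrict_apply (measurableSet_cyl w m), Measure.smul_apply, smul_eq_mul, mul_comm,
        ← ENNReal.toReal_eq_toReal_iff' (measure_ne_top _ _)
          (ENNReal.mul_ne_top (measure_ne_top _ _) (measure_ne_top _ _)), ENNReal.toReal_mul]
      exact hind w m
    intro D hD
    rw [← Measure.restrict_apply hD, this, Measure.smul_apply, smul_eq_mul]
  by_cases h0 : ν A = 0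
  · exact Or.inl h0
  -- Independence of `A` from its own complement gives `ν A * ν Aᶜ = 0`.
  · have := hAA Aᶜ hA.compl
    rw [Set.compl_inter_self, measure_empty, eq_comm, mul_eq_zero] at this
    exact Or.inr (this.resolve_left h0)

end IntSeq

/-! ### Paths of the diagram as integer sequences. -/

namespace IntSeq

/-- The vertex at which the path with steps `w` arrives after `n` steps. -/
noncomputable def vertexOf (w : ℕ → ℤ) (n : ℕ) : ZPascalVertex n := ⟨counts w n, counts_sum w n⟩

/-- The edge that the path with steps `w` traverses after `n` steps. -/
noncomputable def edgeOf (w : ℕ → ℤ) (n : ℕ) : ZPascalEdge n :=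
  ⟨(vertexOf w n, vertexOf w (n + 1)), w n, counts_succ w n⟩

/-- The infinite path with steps `w`. -/
noncomputable def pathOf (w : ℕ → ℤ) : zPascal.InfPath :=
  ⟨fun n => edgeOf w (n + 1), fun _ => rfl⟩

/-- The beginning of the infinite path with steps `w`. -/
noncomputable def finPathOf (w : ℕ → ℤ) (n : ℕ) : zPascal.FinPath n :=
  ⟨fun i => vertexOf w (i + 1), fun i => edgeOf w (i + 1), fun _ => rfl, fun _ => rfl⟩

lemma vertexOf_eq_iff {v w : ℕ → ℤ} {n : ℕ} :
    vertexOf v n = vertexOf w n ↔ counts v n = counts w n :=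
  Subtype.ext_iff

lemma edgeOf_eq_iff {v w : ℕ → ℤ} {n : ℕ} :
    edgeOf v n = edgeOf w n ↔ counts v n = counts w n ∧ v n = w n := by
  refine Subtype.ext_iff.trans (Prod.ext_iff.trans ?_)
  change vertexOf v n = vertexOf w n ∧ vertexOf v (n + 1) = vertexOf w (n + 1) ↔ _
  rw [vertexOf_eq_iff, vertexOf_eq_iff, counts_succ, counts_succ]
  refine and_congr_right fun h => ?_
  rw [h, add_right_inj, Finsupp.single_left_inj one_ne_zero]

lemma counts_one (w : ℕ → ℤ) : counts w 1 = Finsupp.single (w 0) 1 := by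
  simp [counts]

/-- A path with `n` edges fixes `n + 1` steps, since its initial vertex is already a basis vector.
-/
lemma pathOf_preimage_cylinder (w : ℕ → ℤ) (n : ℕ) :
    pathOf ⁻¹' GenBratteliDiagram.cylinder (finPathOf w n) = cyl w (n + 1) := by
  ext v
  change vertexOf v 1 = vertexOf w 1 ∧ (∀ i : Fin n, edgeOf v (i + 1) = edgeOf w (i + 1)) ↔
    ∀ k < n + 1, v k = w k
  constructor
  · rintro ⟨h0, h⟩ (_ | k) hk
    · rw [vertexOf_eq_iff, counts_one, counts_one, Finsupp.single_left_inj one_ne_zero] at h0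
      exact h0
    · exact (edgeOf_eq_iff.1 (h ⟨k, by omega⟩)).2
  · intro h
    exact ⟨vertexOf_eq_iff.2 (counts_congr fun k hk => h k (by omega)), fun i =>
      edgeOf_eq_iff.2 ⟨counts_congr fun k hk => h k (by omega), h _ (by omega)⟩⟩

lemma exists_eq_single (s : ZPascalVertex 1) : ∃ i : ℤ, s.1 = Finsupp.single i 1 :=
  (Finsupp.sum_eq_one_iff s.1).1 s.2

lemma finPathOf_surjective {n : ℕ} (p : zPascal.FinPath n) : ∃ w, finPathOf w n = p := by
  obtain ⟨i, hi⟩ := exists_eq_single (p.vert 0)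
  choose j hj using fun k : Fin n => (p.edge k).2
  -- The value `0` beyond the end of the path is arbitrary: `finPathOf w n` does not see it.
  let w : ℕ → ℤ := fun k => Nat.casesOn k i fun k => if h : k < n then j ⟨k, h⟩ else 0
  have hstep : ∀ k : Fin n, (p.vert k.succ).1 =
      (p.vert k.castSucc).1 + Finsupp.single (w (k + 1)) 1 := by
    intro k
    have hw : w (k + 1) = j k := dif_pos k.2
    rw [hw, ← p.src_edge k, ← p.rng_edge k]
    exact hj k
  have hvert : ∀ k : Fin (n + 1), vertexOf w (k + 1) = p.vert k := by
    intro k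
    induction k using Fin.induction with
    | zero => exact Subtype.ext ((counts_one w).trans hi.symm)
    | succ k ih =>
      refine Subtype.ext ?_
      rw [hstep, ← ih]
      exact counts_succ w _
  have hedge : ∀ k : Fin n, edgeOf w (k + 1) = p.edge k := fun k =>
    Subtype.ext (Prod.ext ((hvert k.castSucc).trans (p.src_edge k).symm)
      ((hvert k.succ).trans (p.rng_edge k).symm))
  refine ⟨w, ?_⟩
  obtain ⟨vert, edge, _, _⟩ := p
  obtain rfl : (fun k : Fin (n + 1) => vertexOf w (k + 1)) = vert := funext hvert
  obtain rfl : (fun k : Fin n => edgeOf w (k + 1)) = edge := funext hedge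
  rfl

lemma pathOf_bijective : Function.Bijective pathOf := by
  constructor
  · intro v w h
    have : v ∈ ⋂ n, cyl w (n + 1) := by
      simp only [Set.mem_iInter, ← pathOf_preimage_cylinder, Set.mem_preimage, h]
      exact fun n => ⟨rfl, fun _ => rfl⟩
    exact funext fun k => Set.mem_iInter.1 this k k (by omega)
  · intro x
    obtain ⟨i, hi⟩ := exists_eq_single (zPascal.src (x.edge 0))
    choose j hj using fun k => (x.edge k).2
    let w : ℕ → ℤ := fun k => Nat.casesOn k i j
    have hsrc : ∀ k, vertexOf w (k + 1) = zPascal.src (x.edge k) := by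
      intro k
      induction k with
      | zero => exact Subtype.ext ((counts_one w).trans hi.symm)
      | succ k ih =>
        rw [← x.chain k]
        refine Subtype.ext ((counts_succ w _).trans ?_)
        exact (congrArg (· + Finsupp.single (j k) 1) (congrArg Subtype.val ih)).trans (hj k).symm
    refine ⟨w, GenBratteliDiagram.InfPath.ext (funext fun k => Subtype.ext (Prod.ext (hsrc k) ?_))⟩
    exact (hsrc (k + 1)).trans (x.chain k).symm

lemma cylinder_finPathOf (w : ℕ → ℤ) (n : ℕ) :
    GenBratteliDiagram.cylinder (finPathOf w n) = pathOf '' cyl w (n + 1) := by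
  rw [← pathOf_preimage_cylinder, Set.image_preimage_eq _ pathOf_bijective.2]

lemma countable_cylinders :
    {C | ∃ (n : ℕ) (p : zPascal.FinPath n), C = GenBratteliDiagram.cylinder p}.Countable := by
  refine ((countable_cyls 0).image (Set.image pathOf)).mono ?_
  rintro _ ⟨n, p, rfl⟩
  obtain ⟨w, rfl⟩ := finPathOf_surjective p
  exact ⟨_, ⟨w, n + 1, Nat.zero_le _, rfl⟩, (cylinder_finPathOf w n).symm⟩

lemma measurable_pathOf : Measurable pathOf := by
  -- Only countably many cylinders exist, so they generate the Borel σ-algebra and not merely the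
  -- topology.
  have : SecondCountableTopology zPascal.InfPath := ⟨⟨_, countable_cylinders, rfl⟩⟩
  have h : borel zPascal.InfPath = MeasurableSpace.generateFrom
      {C | ∃ (n : ℕ) (p : zPascal.FinPath n), C = GenBratteliDiagram.cylinder p} :=
    borel_eq_generateFrom_of_subbasis rfl
  change Measurable[_, borel zPascal.InfPath] pathOf
  rw [h]
  refine measurable_generateFrom ?_
  rintro _ ⟨n, p, rfl⟩
  obtain ⟨w, rfl⟩ := finPathOf_surjective p
  rw [pathOf_preimage_cylinder]
  exact measurableSet_cyl w (n + 1)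

lemma measurableSet_cylinder {n : ℕ} (p : zPascal.FinPath n) :
    MeasurableSet (GenBratteliDiagram.cylinder p) :=
  IsOpen.measurableSet (TopologicalSpace.GenerateOpen.basic _ ⟨n, p, rfl⟩)

/-- Infinite paths correspond to the sequences of their steps. -/
noncomputable def pathEquiv : (ℕ → ℤ) ≃ᵐ zPascal.InfPath where
  toEquiv := Equiv.ofBijective pathOf pathOf_bijective
  measurable_toFun := measurable_pathOf
  measurable_invFun := by
    rw [generateFrom_cyls 1]
    refine measurable_generateFrom ?_
    rintro _ ⟨w, n, hn, rfl⟩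
    obtain ⟨n, rfl⟩ := Nat.exists_eq_succ_of_ne_zero (Nat.one_le_iff_ne_zero.1 hn)
    have : (Equiv.ofBijective pathOf pathOf_bijective).symm ⁻¹' cyl w (n + 1) =
        GenBratteliDiagram.cylinder (finPathOf w n) := by
      rw [cylinder_finPathOf]
      exact ((Equiv.ofBijective pathOf pathOf_bijective).image_eq_preimage_symm _).symm
    exact this ▸ measurableSet_cylinder _

lemma pathEquiv_preimage_cylinder (w : ℕ → ℤ) (n : ℕ) :
    pathEquiv ⁻¹' GenBratteliDiagram.cylinder (finPathOf w n) = cyl w (n + 1) :=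
  pathOf_preimage_cylinder w n

/-- A common edge forces equal counts at its source as well as an equal step; conversely, equal
counts persist as long as the steps agree. -/
lemma tailEquiv_pathEquiv_iff (v w : ℕ → ℤ) :
    GenBratteliDiagram.TailEquiv (pathEquiv v) (pathEquiv w) ↔ TailEquiv v w := by
  change (∃ n, ∀ i, n ≤ i → edgeOf v (i + 1) = edgeOf w (i + 1)) ↔ _
  simp only [edgeOf_eq_iff]
  constructor
  · rintro ⟨n, h⟩
    refine ⟨n + 1, (h n le_rfl).1, fun k hk => ?_⟩
    obtain ⟨k, rfl⟩ := Nat.exists_eq_add_of_le' hk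
    exact (h (k + n) (by omega)).2
  · rintro ⟨n, h, hn⟩
    have hc : ∀ i, n ≤ i → counts v i = counts w i := by
      intro i hi
      induction i, hi using Nat.le_induction with
      | base => exact h
      | succ i hi ih => rw [counts_succ, counts_succ, ih, hn i hi]
    exact ⟨n, fun i hi => ⟨hc _ (by omega), hn _ (by omega)⟩⟩

lemma map_pathEquiv_cylinder (ν : Measure (ℕ → ℤ)) (w : ℕ → ℤ) (n : ℕ) :
    ν.map pathEquiv (GenBratteliDiagram.cylinder (finPathOf w n)) = ν (cyl w (n + 1)) := by
  rw [pathEquiv.map_apply, pathEquiv_preimage_cylinder]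

lemma tailInvariant_map_pathEquiv_iff (ν : Measure (ℕ → ℤ)) :
    GenBratteliDiagram.TailInvariant (ν.map pathEquiv) ↔ Exchangeable ν := by
  constructor
  · rintro h (_ | n) v w hvw
    -- The cylinder of length `0` is the whole space and comes from no finite path.
    · simp [cyl]
    · rw [← map_pathEquiv_cylinder, ← map_pathEquiv_cylinder]
      exact h n _ _ (vertexOf_eq_iff.2 hvw)
  · intro h n p q hpq
    obtain ⟨v, rfl⟩ := finPathOf_surjective p
    obtain ⟨w, rfl⟩ := finPathOf_surjective q
    rw [map_pathEquiv_cylinder, map_pathEquiv_cylinder]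
    exact h _ _ _ (vertexOf_eq_iff.1 hpq)

lemma tailErgodic_map_pathEquiv_iff (ν : Measure (ℕ → ℤ)) :
    GenBratteliDiagram.TailErgodic (ν.map pathEquiv) ↔ TailErgodic ν := by
  constructor
  · intro h A hA hinv
    have := h (pathEquiv.symm ⁻¹' A) (pathEquiv.symm.measurable hA) fun x y hxy =>
      hinv _ _ ((tailEquiv_pathEquiv_iff _ _).1 (by simpa using hxy))
    rwa [← Set.preimage_compl, pathEquiv.map_apply, pathEquiv.map_apply, ← Set.preimage_comp,
      ← Set.preimage_comp, pathEquiv.symm_comp_self] at this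
  · intro h A hA hinv
    rw [pathEquiv.map_apply, pathEquiv.map_apply]
    exact h _ (pathEquiv.measurable hA) fun v w hvw =>
      hinv _ _ ((tailEquiv_pathEquiv_iff v w).2 hvw)

lemma isZPascalMeasure_iff (d : ℤ → ℝ≥0) (hd : HasSum d 1) (μ : Measure zPascal.InfPath) :
    IsZPascalMeasure d μ ↔ μ = (iidMeasure d hd).map pathEquiv := by
  constructor
  · rintro ⟨hμ, -, h⟩
    rw [eq_comm, MeasurableEquiv.map_apply_eq_iff_map_symm_apply_eq]
    have := Measure.isProbabilityMeasure_map (μ := μ) pathEquiv.symm.measurable.aemeasurable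
    refine ext_of_cyl 1 fun w n hn => ?_
    obtain ⟨n, rfl⟩ := Nat.exists_eq_succ_of_ne_zero (Nat.one_le_iff_ne_zero.1 hn)
    rw [Nat.succ_eq_add_one, iidMeasure_cyl, ← counts_prod, ← map_pathEquiv_cylinder,
      pathEquiv.map_map_symm]
    exact (h n (finPathOf w n)).symm
  · rintro rfl
    refine ⟨Measure.isProbabilityMeasure_map pathEquiv.measurable.aemeasurable,
      (tailInvariant_map_pathEquiv_iff _).2 (exchangeable_of_measure_cyl (iidMeasure_cyl d hd)),
      fun n p => ?_⟩
    obtain ⟨w, rfl⟩ := finPathOf_surjective p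
    rw [map_pathEquiv_cylinder, iidMeasure_cyl, ← counts_prod]
    rfl

end IntSeq

/-! ### The main theorem. -/

/-- Every probability vector `d` on `ℤ` determines exactly one measure `μ_d`, and the ergodic tail
invariant Borel probability measures are exactly the measures `μ_d`. -/
theorem mainTheorem5 :
    (∀ d : ℤ → ℝ≥0, HasSum d 1 → ∃! μ : Measure zPascal.InfPath, IsZPascalMeasure d μ) ∧
    {μ : Measure zPascal.InfPath | IsProbabilityMeasure μ ∧
        GenBratteliDiagram.TailInvariant μ ∧ GenBratteliDiagram.TailErgodic μ} =
      {μ : Measure zPascal.InfPath | ∃ d : ℤ → ℝ≥0, HasSum d 1 ∧ IsZPascalMeasure d μ} := by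
  refine ⟨fun d hd => ?_, ?_⟩
  · simp only [IntSeq.isZPascalMeasure_iff d hd, existsUnique_eq]
  ext μ
  constructor
  · rintro ⟨hμ, hinv, herg⟩
    obtain ⟨ν, rfl⟩ : ∃ ν : Measure (ℕ → ℤ), ν.map IntSeq.pathEquiv = μ :=
      ⟨μ.map IntSeq.pathEquiv.symm, IntSeq.pathEquiv.map_map_symm⟩
    have : IsProbabilityMeasure ν :=
      (Measure.isProbabilityMeasure_map_iff IntSeq.pathEquiv.measurable.aemeasurable).1 hμ
    rw [IntSeq.tailInvariant_map_pathEquiv_iff] at hinv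
    rw [IntSeq.tailErgodic_map_pathEquiv_iff] at herg
    -- The vector `d` is the law of the first step, that is, of the initial vertex.
    refine ⟨IntSeq.firstProb ν, IntSeq.hasSum_firstProb ν,
      (IntSeq.isZPascalMeasure_iff _ (IntSeq.hasSum_firstProb ν) _).2 (congrArg _ ?_)⟩
    refine IntSeq.ext_of_cyl 0 fun w n _ => ?_
    rw [IntSeq.iidMeasure_cyl, hinv.measure_cyl_of_tailErgodic herg]
  · rintro ⟨d, hd, h⟩
    refine ⟨h.prob, h.tailInvariant, ?_⟩
    rw [(IntSeq.isZPascalMeasure_iff d hd μ).1 h, IntSeq.tailErgodic_map_pathEquiv_iff]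
    exact IntSeq.tailErgodic_iidMeasure d hd
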